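/- Let $d,m\ge 0$ and $N\ge 1$ be integers and let $\|\cdot\|$ be a norm on $\mathbb R^d$ with dual norm $\|z\|_*=\sup\{z\cdot x:\|x\|\le 1\}$. Let $V\in\mathbb R^{m\times d}$, $v\in\mathbb R^m$, $\Xi=\{p\in\mathbb R^d: Vp\le v\}$, and let $p^1,\dots,p^N\in\Xi$ be samples with empirical distribution $\hat{\mathbb P}=\frac1N\sum_{i}\delta_{p^i}$. For $\varepsilon\ge 0$ let $\mathcal P$ be the set of all probability distributions $\mathbb Q$ supported on $\Xi$ with finite mean and $d_W(\hat{\mathbb P},\mathbb Q)\le\varepsilon$, where $d_W(\mathbb Q_1,\mathbb Q_2)=\inf_\Pi\int\|\xi_1-\xi_2\|\,\Pi(d\xi_1,d\xi_2)$ over all joint distributions $\Pi$ with marginals $\mathbb Q_1,\mathbb Q_2$. Let $\alpha\in(0,1]$, $\delta\in\mathbb R$, $h\in\mathbb R^d$, and let $\mathcal O,\mathcal A\subset\mathbb R^d$ be nonempty, convex and compact (the shapes of the obstacle and of the robot). For $g\in\mathbb R$ put $\tilde g=g-\big(S_{\mathcal O}(h)+S_{-\mathcal A}(h)\big)$ with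 $S_C(z)=\sup_{x\in C}z\cdot x$, and $\ell_g(p)=-(h\cdot p+\tilde g)$. Let $$\mathrm{CVaR}_\alpha^{\mathbb Q}(\ell)=\inf_{\tau\in\mathbb R}\mathbb E^{\mathbb Q}\big[\tau+\tfrac1\alpha\max\{\ell(p)-\tau,0\}\big],\qquad \mathrm{DR\text{-}CVaR}_\alpha^\varepsilon(\ell)=\sup_{\mathbb Q\in\mathcal P}\mathrm{CVaR}_\alpha^{\mathbb Q}(\ell).$$ Put $a_1=-h/\alpha$, $b_1=-1/\alpha$, $c_1=1-1/\alpha$, $a_2=0$, $b_2=0$, $c_2=1$. Then the problem $$\min_{g\in\mathbb R}\ g\quad\text{subject to}\quad \mathrm{DR\text{-}CVaR}_\alpha^\varepsilon(\ell_g(p))\le\delta \tag{1}$$ admits the finite-dimensional reformulation, in the variables $g,\tau,\lambda\in\mathbb R$, $\eta_i\in\mathbb R$, $\gamma_{ik}\in\mathbb R^m$ ($i=1,\dots,N$, $k=1,2$), $$\inf\ g\quad\text{subject to}\quad \lambda\varepsilon+\frac1N\sum_{i=1}^N\eta_i\le\delta,\quad a_k\cdot p^i+b_k\tilde g+c_k\tau+\gamma_{ik}\cdot(v-Vp^i)\le\eta_i,\quad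 \|V^\top\gamma_{ik}-a_k\|_*\le\lambda,\quad \gamma_{ik}\ge0\quad(\forall i,k). \tag{2}$$ That is: the feasible set of (2) is convex; a real number $g$ is feasible for (1) if and only if there are $\tau,\lambda,\eta_i,\gamma_{ik}$ such that $(g,\tau,\lambda,\eta,\gamma)$ is feasible for (2); and both problems attain their minima, with the same finite optimal value. -/

import Mathlib

open MeasureTheory
open scoped ENNReal Matrix Pointwise

noncomputable section

namespace DRCVaR

/-- The support function `S_C(z) = sup_{x ∈ C} z · x`. -/
def supportFn {d : ℕ} (C : Set (Fin d → ℝ)) (z : Fin d → ℝ) : ℝ :=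
  sSup ((fun x => z ⬝ᵥ x) '' C)

/-- The dual norm `‖z‖_* = sup {z · x : ‖x‖ ≤ 1}` of a norm `nrm` on `ℝ^d`. -/
def dualNorm {d : ℕ} (nrm : Seminorm ℝ (Fin d → ℝ)) (z : Fin d → ℝ) : ℝ :=
  sSup ((fun x => z ⬝ᵥ x) '' {x | nrm x ≤ 1})

/-- The polyhedron `Ξ = {p | V p ≤ v}` (componentwise inequality). -/
def polyhedron {d m : ℕ} (V : Matrix (Fin m) (Fin d) ℝ) (v : Fin m → ℝ) : Set (Fin d → ℝ) :=
  {p | V *ᵥ p ≤ v}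

/-- `𝓜(Ξ)`: the probability distributions on `ℝ^d` with finite mean that are supported on `Ξ`. -/
def finiteMeanMeasures {d : ℕ} (Ξ : Set (Fin d → ℝ)) : Set (Measure (Fin d → ℝ)) :=
  {Q | IsProbabilityMeasure Q ∧ Q Ξᶜ = 0 ∧ Integrable (fun p : Fin d → ℝ => p) Q}

/-- The Wasserstein distance with transportation cost `nrm (ξ₁ - ξ₂)`: the infimum of the
transportation cost over all joint distributions with marginals `Q₁` and `Q₂`. -/
def wasserstein {d : ℕ} (nrm : Seminorm ℝ (Fin d → ℝ)) (Q₁ Q₂ : Measure (Fin d → ℝ)) : ℝ≥0∞ :=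
  ⨅ (π : Measure ((Fin d → ℝ) × (Fin d → ℝ))) (_ : π.map Prod.fst = Q₁ ∧ π.map Prod.snd = Q₂),
    ∫⁻ ξ, ENNReal.ofReal (nrm (ξ.1 - ξ.2)) ∂π

/-- The empirical distribution of the samples `p 0, …, p (N - 1)`. -/
def empirical {d N : ℕ} (p : Fin N → Fin d → ℝ) : Measure (Fin d → ℝ) :=
  (N : ℝ≥0∞)⁻¹ • ∑ i, Measure.dirac (p i)

/-- The Wasserstein ball of radius `ε` around `P`, inside `𝓜(Ξ)`. -/
def wassersteinBall {d : ℕ} (nrm : Seminorm ℝ (Fin d → ℝ)) (Ξ : Set (Fin d → ℝ))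
    (P : Measure (Fin d → ℝ)) (ε : ℝ) : Set (Measure (Fin d → ℝ)) :=
  {Q | Q ∈ finiteMeanMeasures Ξ ∧ wasserstein nrm P Q ≤ ENNReal.ofReal ε}

/-- `CVaR_α^P(l) = inf_τ E^P[τ + max(l - τ, 0) / α]`, as an extended real number
(it is only used for `P`-integrable losses `l`). -/
def cvar {d : ℕ} (α : ℝ) (P : Measure (Fin d → ℝ)) (l : (Fin d → ℝ) → ℝ) : EReal :=
  ⨅ τ : ℝ, ((∫ p, (τ + 1 / α * max (l p - τ) 0) ∂P : ℝ) : EReal)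

/-- The distributionally robust CVaR: the supremum of `CVaR_α^Q(l)` over the ambiguity set. -/
def drcvar {d : ℕ} (α : ℝ) (amb : Set (Measure (Fin d → ℝ))) (l : (Fin d → ℝ) → ℝ) : EReal :=
  ⨆ Q ∈ amb, cvar α Q l

/-- `g̃ = g - (S_𝒪(h) + S_{-𝒜}(h))`. -/
def gTilde {d : ℕ} (𝒪 𝒜 : Set (Fin d → ℝ)) (h : Fin d → ℝ) (g : ℝ) : ℝ :=
  g - (supportFn 𝒪 h + supportFn (-𝒜) h)

/-- The signed collision loss `ℓ(p) = -(h · p + g̃)`. -/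
def loss {d : ℕ} (𝒪 𝒜 : Set (Fin d → ℝ)) (h : Fin d → ℝ) (g : ℝ) (p : Fin d → ℝ) : ℝ :=
  -(h ⬝ᵥ p + gTilde 𝒪 𝒜 h g)

/-- Coefficients `a₁ = -h / α`, `a₂ = 0`. -/
def coeffA {d : ℕ} (α : ℝ) (h : Fin d → ℝ) : Fin 2 → Fin d → ℝ := ![(-1 / α) • h, 0]

/-- Coefficients `b₁ = -1 / α`, `b₂ = 0`. -/
def coeffB (α : ℝ) : Fin 2 → ℝ := ![-1 / α, 0]

/-- Coefficients `c₁ = 1 - 1 / α`, `c₂ = 1`. -/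
def coeffC (α : ℝ) : Fin 2 → ℝ := ![1 - 1 / α, 1]

/-- The constraints of the finite-dimensional program in the variables `g, τ, λ, η_i, γ_ik`;
here `gt` stands for `g̃`. -/
structure ReformFeasible {d m N : ℕ} (nrm : Seminorm ℝ (Fin d → ℝ))
    (V : Matrix (Fin m) (Fin d) ℝ) (v : Fin m → ℝ) (p : Fin N → Fin d → ℝ) (h : Fin d → ℝ)
    (α ε δ : ℝ) (gt τ lam : ℝ) (η : Fin N → ℝ) (γ : Fin N → Fin 2 → Fin m → ℝ) : Prop where
  budget : lam * ε + 1 / (N : ℝ) * ∑ i, η i ≤ δ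
  epigraph : ∀ i k, coeffA α h k ⬝ᵥ p i + coeffB α k * gt + coeffC α k * τ
    + γ i k ⬝ᵥ (v - V *ᵥ p i) ≤ η i
  dual_norm_le : ∀ i k, dualNorm nrm (Vᵀ *ᵥ γ i k - coeffA α h k) ≤ lam
  nonneg : ∀ i k, 0 ≤ γ i k

end DRCVaR

end

/-! The equivalence closes a cycle of implications through a finite-dimensional condition,
`TransportBound`. A plan moves the fraction `w i` of sample `i` by `y i / w i` inside the polyhedron
and moves mass `α` in total; cost and tail loss depend only on `(w, y)`, the loss linearly. The
moved mass plays the role of the worst `α`-tail in the dual description of CVaR, so no interchange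
of `inf` over `τ` with `sup` over distributions is needed.

From (1) to plans (`transportBound_of_drcvar_le`): a plan with all `w i > 0` is realized by a
distribution in the ball whose CVaR is at least the average tail loss; the other plans are limits of
such plans.

From plans to (2) (`TransportBound.exists_reformFeasible`): a Lagrange multiplier `λ` prices the
cost, a Hahn–Banach sandwich replaces `λ` times the cost by a linear functional `z` below it, and
Farkas' lemma on the polytope yields the remaining variables. The bound on `z` becomes the dual norm
constraint.

From (2) to (1) (`ReformFeasible.drcvar_le`): the constraints bound the CVaR integrand on the
polyhedron by `η i + λ ‖q - p i‖`, and integrating over a near-optimal coupling gives the budget.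

The minimum exists because the offset enters the tail loss of every plan through the same constant
`-N * t`: the admissible offsets are the upper bounds of a nonempty bounded set of reals. -/

namespace DRCVaR

/-! ### Farkas' lemma, the sandwich theorem and Lagrange multipliers -/

section ConvexDuality

/-- Farkas' lemma for finitely many linear functionals on a real vector space. -/
theorem farkas {ι E : Type*} [AddCommGroup E] [Module ℝ E] (s : Finset ι) :
    ∀ (f : ι → E →ₗ[ℝ] ℝ) (g : E →ₗ[ℝ] ℝ), (∀ x, (∀ i ∈ s, f i x ≤ 0) → g x ≤ 0) →
      ∃ c : ι → ℝ, (∀ i, 0 ≤ c i) ∧ ∀ x, g x = ∑ i ∈ s, c i * f i x := by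
  classical
  induction s using Finset.induction_on with
  | empty =>
    intro f g hg
    refine ⟨0, fun _ => le_rfl, fun x => ?_⟩
    have h1 := hg x (by simp)
    have h2 := hg (-x) (by simp)
    rw [map_neg] at h2
    simp only [Finset.sum_empty]
    linarith
  | insert j s hj ih =>
    intro f g hg
    by_cases hs : ∀ x, (∀ i ∈ s, f i x ≤ 0) → g x ≤ 0
    · obtain ⟨c, hc, hgc⟩ := ih f g hs
      refine ⟨Function.update c j 0, fun i => ?_, fun x => ?_⟩
      · by_cases hij : i = j
        · simp [hij]
        · simpa [hij] using hc i
      · rw [Finset.sum_insert hj, hgc x, Function.update_self, zero_mul, zero_add]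
        refine Finset.sum_congr rfl fun i hi => ?_
        rw [Function.update_of_ne (ne_of_mem_of_not_mem hi hj)]
    · push Not at hs
      obtain ⟨x₀, hx₀, hgx₀⟩ := hs
      have hfj : 0 < f j x₀ := by
        by_contra! hle
        refine absurd (hg x₀ fun i hi => ?_) (not_le.2 hgx₀)
        rcases Finset.mem_insert.1 hi with rfl | hi
        · exact hle
        · exact hx₀ i hi
      -- The new functionals are `f i` and `g` composed with the projection onto the kernel of `f j`
      -- along `x₀`. On that kernel the constraint `j` is free, so the induction hypothesis applies.
      obtain ⟨c, hc, hgc⟩ := ih (fun i => f i - (f i x₀ / f j x₀) • f j)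
        (g - (g x₀ / f j x₀) • f j) (by
          intro x hx
          have key := hg (x - (f j x / f j x₀) • x₀) (by
            intro i hi
            rcases Finset.mem_insert.1 hi with rfl | hi
            · simp only [map_sub, map_smul, smul_eq_mul]
              rw [div_mul_cancel₀ _ hfj.ne', sub_self]
            · have := hx i hi
              simp only [LinearMap.sub_apply, LinearMap.smul_apply, smul_eq_mul] at this
              simp only [map_sub, map_smul, smul_eq_mul]
              calc f i x - f j x / f j x₀ * f i x₀ = f i x - f i x₀ / f j x₀ * f j x := by ring
                _ ≤ 0 := this)
          simp only [map_sub, map_smul, smul_eq_mul] at key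
          simp only [LinearMap.sub_apply, LinearMap.smul_apply, smul_eq_mul]
          calc g x - g x₀ / f j x₀ * f j x = g x - f j x / f j x₀ * g x₀ := by ring
            _ ≤ 0 := key)
      -- This is the coefficient of `f j` after undoing the projection; it is nonnegative because `g
      -- x₀ > 0` and every other `f i x₀ ≤ 0`.
      have hcoef : 0 ≤ (g x₀ - ∑ i ∈ s, c i * f i x₀) / f j x₀ := by
        refine div_nonneg (sub_nonneg.2 (le_trans ?_ hgx₀.le)) hfj.le
        exact Finset.sum_nonpos fun i hi => mul_nonpos_of_nonneg_of_nonpos (hc i) (hx₀ i hi)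
      refine ⟨Function.update c j ((g x₀ - ∑ i ∈ s, c i * f i x₀) / f j x₀), fun i => ?_,
        fun x => ?_⟩
      · by_cases hij : i = j
        · subst hij
          simpa using hcoef
        · simpa [hij] using hc i
      · have hx := hgc x
        simp only [LinearMap.sub_apply, LinearMap.smul_apply, smul_eq_mul] at hx
        have hsum : ∑ i ∈ s, Function.update c j ((g x₀ - ∑ i ∈ s, c i * f i x₀) / f j x₀) i
            * f i x = ∑ i ∈ s, c i * f i x :=
          Finset.sum_congr rfl fun i hi => by
            rw [Function.update_of_ne (ne_of_mem_of_not_mem hi hj)]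
        have hexp : ∑ i ∈ s, c i * (f i x - f i x₀ / f j x₀ * f j x)
            = ∑ i ∈ s, c i * f i x - (∑ i ∈ s, c i * f i x₀) / f j x₀ * f j x := by
          rw [Finset.sum_div, Finset.sum_mul, ← Finset.sum_sub_distrib]
          exact Finset.sum_congr rfl fun i _ => by ring
        rw [Finset.sum_insert hj, Function.update_self, hsum, sub_div, sub_mul]
        linarith

/-- The affine form of Farkas' lemma: an affine inequality valid on a nonempty polyhedron is a
nonnegative combination of the inequalities that define it. -/
theorem affine_farkas {ι E : Type*} [Fintype ι] [AddCommGroup E] [Module ℝ E]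
    (f : ι → E →ₗ[ℝ] ℝ) (b : ι → ℝ) (g : E →ₗ[ℝ] ℝ) (s : ℝ) {x₀ : E} (hx₀ : ∀ i, f i x₀ ≤ b i)
    (hg : ∀ x, (∀ i, f i x ≤ b i) → g x ≤ s) :
    ∃ c : ι → ℝ, (∀ i, 0 ≤ c i) ∧ (∀ x, g x = ∑ i, c i * f i x) ∧ ∑ i, c i * b i ≤ s := by
  classical
  -- Homogenization: a coordinate `t ≥ 0` (the index `none`) turns `f i x ≤ b i` into `f i x ≤ b i *
  -- t`. The multiplier of `none` is the slack in the final inequality.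
  obtain ⟨c, hc, hgc⟩ := farkas (Finset.univ : Finset (Option ι))
    (fun o => o.elim (-LinearMap.snd ℝ E ℝ)
      (fun i => f i ∘ₗ LinearMap.fst ℝ E ℝ - b i • LinearMap.snd ℝ E ℝ))
    (g ∘ₗ LinearMap.fst ℝ E ℝ - s • LinearMap.snd ℝ E ℝ) (by
      rintro ⟨x, t⟩ hx
      have ht : 0 ≤ t := by simpa using hx none (Finset.mem_univ _)
      have hf : ∀ i, f i x ≤ b i * t := fun i => by simpa using hx (some i) (Finset.mem_univ _)
      suffices g x ≤ s * t by simpa using this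
      rcases ht.eq_or_lt with rfl | ht
      -- At `t = 0` the vector `x` is a recession direction. If `g x > 0`, a step of this length
      -- from `x₀` stays in the polyhedron and raises `g` above `s`.
      · rw [mul_zero]
        by_contra! hpos
        have key := hg (x₀ + ((|s - g x₀| + 1) / g x) • x) (fun i => by
          rw [map_add, map_smul, smul_eq_mul]
          have h1 : f i x ≤ 0 := by simpa using hf i
          have h2 := mul_nonpos_of_nonneg_of_nonpos
            (div_nonneg (by positivity : (0 : ℝ) ≤ |s - g x₀| + 1) hpos.le) h1
          linarith [hx₀ i])
        rw [map_add, map_smul, smul_eq_mul, div_mul_cancel₀ _ hpos.ne'] at key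
        linarith [le_abs_self (s - g x₀)]
      · have key := hg (t⁻¹ • x) (fun i => by
          rw [map_smul, smul_eq_mul, inv_mul_le_iff₀ ht, mul_comm]
          exact hf i)
        rwa [map_smul, smul_eq_mul, inv_mul_le_iff₀ ht, mul_comm] at key)
  refine ⟨fun i => c (some i), fun i => hc _, fun x => ?_, ?_⟩
  · simpa [Fintype.sum_option] using hgc (x, 0)
  · have h1 := hgc (0, 1)
    have h0 := hc none
    simp [Fintype.sum_option] at h1
    linarith

/-- Hahn–Banach sandwich theorem: an affine function dominated by a continuous seminorm on a convex
set is separated from the seminorm by a linear functional. -/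
theorem exists_linear_between {E : Type*} [NormedAddCommGroup E] [NormedSpace ℝ E]
    (ρ : Seminorm ℝ E) (hρ : Continuous ρ) {K : Set E} (hK : Convex ℝ K) (hne : K.Nonempty)
    (L : E →ₗ[ℝ] ℝ) (c : ℝ) (hL : ∀ x ∈ K, L x - c ≤ ρ x) :
    ∃ z : E →ₗ[ℝ] ℝ, (∀ x, z x ≤ ρ x) ∧ ∀ x ∈ K, L x - c ≤ z x := by
  have hA : Convex ℝ {q : E × ℝ | q.1 ∈ Set.univ ∧ ρ q.1 < q.2} :=
    ρ.convexOn.convex_strict_epigraph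
  have hAo : IsOpen {q : E × ℝ | q.1 ∈ Set.univ ∧ ρ q.1 < q.2} := by
    simp only [Set.mem_univ, true_and]
    exact isOpen_lt (hρ.comp continuous_fst) continuous_snd
  have hB : Convex ℝ {q : E × ℝ | q.1 ∈ K ∧ q.2 ≤ L q.1 - c} := by
    have : ConcaveOn ℝ K fun x => L x - c := (L.concaveOn hK).sub (convexOn_const c hK)
    exact this.convex_hypograph
  -- The open strict epigraph of `ρ` is separated from the hypograph of `L - c` over `K`. The
  -- separating hyperplane is not vertical (`hs`), and homogeneity of `ρ` lets it be moved to the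
  -- origin (`hu`, `hle`).
  obtain ⟨f, u, hfA, hfB⟩ := geometric_hahn_banach_open hA hAo hB (by
    rw [Set.disjoint_left]
    rintro ⟨x, t⟩ ⟨-, h1⟩ ⟨h2, h3⟩
    exact absurd (hL x h2) (not_le.2 (h1.trans_le h3)))
  have hsplit : ∀ x t, f (x, t) = f (x, 0) + t * f (0, 1) := fun x t => by
    rw [← smul_eq_mul, ← map_smul, ← map_add]
    simp
  obtain ⟨k, hk⟩ := hne
  have hs : f (0, 1) < 0 := by
    have h1 := hfA (k, ρ k + 1) ⟨trivial, by simp⟩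
    have h2 := hfB (k, L k - c) ⟨hk, le_rfl⟩
    rw [hsplit] at h1 h2
    nlinarith [hL k hk]
  have hu : 0 ≤ u := by
    by_contra! hu
    have h1 := hfA (0, u / (2 * f (0, 1))) ⟨trivial, by
      rw [map_zero]
      exact div_pos_of_neg_of_neg hu (by linarith)⟩
    rw [hsplit, show ((0 : E), (0 : ℝ)) = 0 from rfl, map_zero] at h1
    have : u / (2 * f (0, 1)) * f (0, 1) = u / 2 := by
      rw [div_mul_eq_mul_div, mul_div_mul_right _ _ hs.ne]
    linarith
  have hle : ∀ x, f (x, 0) + ρ x * f (0, 1) ≤ 0 := by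
    intro x
    by_contra! hpos
    set a := f (x, 0) + ρ x * f (0, 1) with ha
    obtain ⟨r, hr0, hr⟩ : ∃ r : ℝ, 0 < r ∧ u - f (0, 1) < r * a :=
      ⟨(u - f (0, 1) + 1) / a, div_pos (by linarith) hpos, by
        rw [div_mul_cancel₀ _ hpos.ne']; linarith⟩
    have h1 := hfA (r • x, ρ (r • x) + 1) ⟨trivial, by simp⟩
    rw [hsplit, map_smul_eq_mul, Real.norm_of_nonneg hr0.le,
      show ((r • x, (0 : ℝ)) : E × ℝ) = r • (x, 0) by simp, map_smul, smul_eq_mul] at h1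
    nlinarith
  refine ⟨(-f (0, 1))⁻¹ • ((f : E × ℝ →ₗ[ℝ] ℝ) ∘ₗ LinearMap.inl ℝ E ℝ), fun x => ?_,
    fun x hx => ?_⟩
  · have := hle x
    simp only [LinearMap.smul_apply, LinearMap.comp_apply, LinearMap.inl_apply, smul_eq_mul,
      ContinuousLinearMap.coe_coe]
    rw [inv_mul_le_iff₀ (by linarith)]
    linarith
  · have := hfB (x, L x - c) ⟨hx, le_rfl⟩
    rw [hsplit] at this
    simp only [LinearMap.smul_apply, LinearMap.comp_apply, LinearMap.inl_apply, smul_eq_mul,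
      ContinuousLinearMap.coe_coe]
    rw [le_inv_mul_iff₀ (by linarith)]
    linarith

/-- A Lagrange multiplier for maximizing a linear function over a convex set under a single convex
constraint that satisfies Slater's condition. -/
theorem exists_lagrange_multiplier {E : Type*} [AddCommGroup E] [Module ℝ E] {K : Set E}
    {ρ : E → ℝ} (hρ : ConvexOn ℝ K ρ) (L : E →ₗ[ℝ] ℝ) {c e : ℝ} {x₀ : E} (hx₀ : x₀ ∈ K)
    (hslater : ρ x₀ < e) (hL : ∀ x ∈ K, ρ x ≤ e → L x ≤ c) :
    ∃ lam : ℝ, 0 ≤ lam ∧ ∀ x ∈ K, L x ≤ c + lam * (ρ x - e) := by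
  -- Points with `ρ x > e` bound the multiplier from below, points with `ρ x < e` from above, and
  -- `0` is added to the lower bounds to force the sign. The bounds are compatible: mixing one point
  -- of each kind so that the convexity bound on `ρ` equals `e` gives a feasible point.
  obtain ⟨lam, hlo, hhi⟩ := exists_between_of_forall_le
    (s := insert 0 {r | ∃ x ∈ K, e < ρ x ∧ r = (L x - c) / (ρ x - e)})
    (t := {r | ∃ x ∈ K, ρ x < e ∧ r = (c - L x) / (e - ρ x)})
    ⟨0, Set.mem_insert _ _⟩ ⟨_, x₀, hx₀, hslater, rfl⟩ (by
      rintro r (rfl | ⟨x, hx, hxe, rfl⟩) _ ⟨y, hy, hye, rfl⟩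
      · exact div_nonneg (sub_nonneg.2 (hL y hy hye.le)) (sub_nonneg.2 hye.le)
      · have h1 : 0 < ρ x - e := sub_pos.2 hxe
        have h2 : 0 < e - ρ y := sub_pos.2 hye
        have hd : 0 < (ρ x - e) + (e - ρ y) := by linarith
        have ha : 0 ≤ (e - ρ y) / ((ρ x - e) + (e - ρ y)) := by positivity
        have hb : 0 ≤ (ρ x - e) / ((ρ x - e) + (e - ρ y)) := by positivity
        have hab : (e - ρ y) / ((ρ x - e) + (e - ρ y)) + (ρ x - e) / ((ρ x - e) + (e - ρ y))
            = 1 := by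
          rw [← add_div, add_comm]; exact div_self hd.ne'
        have hmid := hL _ (hρ.1 hx hy ha hb hab) ((hρ.2 hx hy ha hb hab).trans_eq (by
          simp only [smul_eq_mul]
          field_simp
          ring))
        simp only [map_add, map_smul, smul_eq_mul] at hmid
        rw [div_mul_eq_mul_div, div_mul_eq_mul_div, ← add_div, div_le_iff₀ hd] at hmid
        rw [div_le_div_iff₀ h1 h2]
        linarith)
  refine ⟨lam, hlo (Set.mem_insert _ _), fun x hx => ?_⟩
  rcases lt_trichotomy (ρ x) e with h | h | h
  · have := hhi ⟨x, hx, h, rfl⟩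
    rw [le_div_iff₀ (sub_pos.2 h)] at this
    linarith
  · rw [h, sub_self, mul_zero, add_zero]
    exact hL x hx h.le
  · have := hlo (Set.mem_insert_of_mem _ ⟨x, hx, h, rfl⟩)
    rw [div_le_iff₀ (sub_pos.2 h)] at this
    linarith

end ConvexDuality

/-! ### Norms on `ℝ^d` and their duals -/

section Norms

variable {d : ℕ}

theorem continuous_seminorm (nrm : Seminorm ℝ (Fin d → ℝ)) : Continuous nrm := by
  rw [← continuousOn_univ]
  exact nrm.convexOn.continuousOn isOpen_univ

/-- A norm on `ℝ^d` dominates a multiple of the supremum norm. -/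
theorem exists_norm_le_mul {nrm : Seminorm ℝ (Fin d → ℝ)} (hnrm : ∀ x, nrm x = 0 → x = 0) :
    ∃ C : ℝ, 0 < C ∧ ∀ x, ‖x‖ ≤ C * nrm x := by
  rcases (Metric.sphere (0 : Fin d → ℝ) 1).eq_empty_or_nonempty with hS | hS
  -- The sphere is empty only in dimension zero.
  · refine ⟨1, one_pos, fun x => ?_⟩
    rcases eq_or_ne x 0 with rfl | hx
    · simp
    · exact absurd (show ‖x‖⁻¹ • x ∈ Metric.sphere (0 : Fin d → ℝ) 1 by simp [norm_smul, hx])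
        (hS ▸ Set.notMem_empty _)
  · obtain ⟨y, hy, hmin⟩ := (isCompact_sphere (0 : Fin d → ℝ) 1).exists_isMinOn hS
      (continuous_seminorm nrm).continuousOn
    have hy0 : 0 < nrm y := by
      refine lt_of_le_of_ne (apply_nonneg _ _) fun h0 => ?_
      rw [hnrm y h0.symm] at hy
      simp at hy
    refine ⟨(nrm y)⁻¹, inv_pos.2 hy0, fun x => ?_⟩
    rcases eq_or_ne x 0 with rfl | hx
    · simp
    · have hx' : 0 < ‖x‖ := norm_pos_iff.2 hx
      have h1 : nrm y ≤ nrm (‖x‖⁻¹ • x) := hmin (by simp [norm_smul, hx])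
      rw [map_smul_eq_mul, norm_inv, norm_norm, le_inv_mul_iff₀ hx'] at h1
      rwa [le_inv_mul_iff₀ hy0, mul_comm]

theorem continuous_dotProduct_left (z : Fin d → ℝ) : Continuous fun x : Fin d → ℝ => z ⬝ᵥ x := by
  simp only [dotProduct]
  fun_prop

/-- Without this bound the real `sSup` in `dualNorm` could take its default value `0`; equivalence
of norms rules that out. -/
theorem bddAbove_dualNorm {nrm : Seminorm ℝ (Fin d → ℝ)} (hnrm : ∀ x, nrm x = 0 → x = 0)
    (z : Fin d → ℝ) : BddAbove ((fun x => z ⬝ᵥ x) '' {x | nrm x ≤ 1}) := by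
  obtain ⟨C, hC, h⟩ := exists_norm_le_mul hnrm
  have hK : IsCompact (Metric.closedBall (0 : Fin d → ℝ) C) := isCompact_closedBall _ _
  refine (hK.image (continuous_dotProduct_left z)).bddAbove.mono (Set.image_mono fun x hx => ?_)
  rw [mem_closedBall_zero_iff]
  exact (h x).trans (mul_le_of_le_one_right hC.le hx)

theorem dualNorm_nonneg {nrm : Seminorm ℝ (Fin d → ℝ)} (hnrm : ∀ x, nrm x = 0 → x = 0)
    (z : Fin d → ℝ) : 0 ≤ dualNorm nrm z :=
  le_csSup (bddAbove_dualNorm hnrm z) ⟨0, by simp, by simp⟩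

theorem dotProduct_le_dualNorm_mul {nrm : Seminorm ℝ (Fin d → ℝ)} (hnrm : ∀ x, nrm x = 0 → x = 0)
    (z x : Fin d → ℝ) : z ⬝ᵥ x ≤ dualNorm nrm z * nrm x := by
  rcases (apply_nonneg nrm x).eq_or_lt with h0 | h0
  · simp [hnrm x h0.symm]
  · have h1 : z ⬝ᵥ ((nrm x)⁻¹ • x) ≤ dualNorm nrm z :=
      le_csSup (bddAbove_dualNorm hnrm z) ⟨_, by
        simp only [Set.mem_ofPred_eq, map_smul_eq_mul, norm_inv, Real.norm_of_nonneg h0.le]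
        rw [inv_mul_cancel₀ h0.ne'], rfl⟩
    rw [dotProduct_smul, smul_eq_mul, inv_mul_le_iff₀ h0] at h1
    linarith

theorem dualNorm_le_of_forall {nrm : Seminorm ℝ (Fin d → ℝ)} {z : Fin d → ℝ} {lam : ℝ}
    (hlam : 0 ≤ lam) (h : ∀ x, z ⬝ᵥ x ≤ lam * nrm x) : dualNorm nrm z ≤ lam := by
  refine csSup_le ⟨_, 0, by simp, rfl⟩ ?_
  rintro _ ⟨x, hx, rfl⟩
  exact (h x).trans (mul_le_of_le_one_right hlam hx)

theorem dualNorm_add_le {nrm : Seminorm ℝ (Fin d → ℝ)} (hnrm : ∀ x, nrm x = 0 → x = 0)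
    (z w : Fin d → ℝ) : dualNorm nrm (z + w) ≤ dualNorm nrm z + dualNorm nrm w := by
  refine dualNorm_le_of_forall (add_nonneg (dualNorm_nonneg hnrm z) (dualNorm_nonneg hnrm w))
    fun x => ?_
  rw [add_dotProduct, add_mul]
  exact add_le_add (dotProduct_le_dualNorm_mul hnrm z x) (dotProduct_le_dualNorm_mul hnrm w x)

theorem dualNorm_smul_le {nrm : Seminorm ℝ (Fin d → ℝ)} (hnrm : ∀ x, nrm x = 0 → x = 0)
    {r : ℝ} (hr : 0 ≤ r) (z : Fin d → ℝ) : dualNorm nrm (r • z) ≤ r * dualNorm nrm z := by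
  refine dualNorm_le_of_forall (mul_nonneg hr (dualNorm_nonneg hnrm z)) fun x => ?_
  rw [smul_dotProduct, smul_eq_mul, mul_assoc]
  exact mul_le_mul_of_nonneg_left (dotProduct_le_dualNorm_mul hnrm z x) hr

end Norms

/-! ### Convexity of the reformulated program -/

section Convexity

theorem gTilde_combo {d : ℕ} (𝒪 𝒜 : Set (Fin d → ℝ)) (h : Fin d → ℝ) {a b : ℝ} (hab : a + b = 1)
    (g g' : ℝ) :
    gTilde 𝒪 𝒜 h (a * g + b * g') = a * gTilde 𝒪 𝒜 h g + b * gTilde 𝒪 𝒜 h g' := by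
  simp only [gTilde]
  linear_combination (supportFn 𝒪 h + supportFn (-𝒜) h) * hab

/-- The constraints of the finite-dimensional program are jointly convex. -/
theorem ReformFeasible.combo {d m N : ℕ} {nrm : Seminorm ℝ (Fin d → ℝ)}
    (hnrm : ∀ x, nrm x = 0 → x = 0) {V : Matrix (Fin m) (Fin d) ℝ} {v : Fin m → ℝ}
    {p : Fin N → Fin d → ℝ} {h : Fin d → ℝ} {α ε δ : ℝ}
    {gt τ lam : ℝ} {η : Fin N → ℝ} {γ : Fin N → Fin 2 → Fin m → ℝ}
    {gt' τ' lam' : ℝ} {η' : Fin N → ℝ} {γ' : Fin N → Fin 2 → Fin m → ℝ}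
    (H : ReformFeasible nrm V v p h α ε δ gt τ lam η γ)
    (H' : ReformFeasible nrm V v p h α ε δ gt' τ' lam' η' γ')
    {a b : ℝ} (ha : 0 ≤ a) (hb : 0 ≤ b) (hab : a + b = 1) :
    ReformFeasible nrm V v p h α ε δ (a * gt + b * gt') (a * τ + b * τ') (a * lam + b * lam')
      (a • η + b • η') (a • γ + b • γ') where
  budget := by
    have h1 := add_le_add (mul_le_mul_of_nonneg_left H.budget ha)
      (mul_le_mul_of_nonneg_left H'.budget hb)
    rw [← add_mul, hab, one_mul] at h1
    refine le_of_eq_of_le ?_ h1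
    simp only [Pi.add_apply, Pi.smul_apply, smul_eq_mul, Finset.sum_add_distrib, ← Finset.mul_sum]
    ring
  epigraph i k := by
    have h1 := add_le_add (mul_le_mul_of_nonneg_left (H.epigraph i k) ha)
      (mul_le_mul_of_nonneg_left (H'.epigraph i k) hb)
    refine le_of_eq_of_le ?_ h1
    simp only [Pi.add_apply, Pi.smul_apply, add_dotProduct, smul_dotProduct, smul_eq_mul]
    linear_combination (-(coeffA α h k ⬝ᵥ p i)) * hab
  dual_norm_le i k := by
    have h1 : Vᵀ *ᵥ (a • γ + b • γ') i k - coeffA α h k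
        = a • (Vᵀ *ᵥ γ i k - coeffA α h k) + b • (Vᵀ *ᵥ γ' i k - coeffA α h k) := by
      simp only [Pi.add_apply, Pi.smul_apply, Matrix.mulVec_add, Matrix.mulVec_smul, smul_sub]
      nth_rewrite 1 [← one_smul ℝ (coeffA α h k)]
      rw [← hab, add_smul]
      abel
    rw [h1]
    refine (dualNorm_add_le hnrm _ _).trans (add_le_add ?_ ?_)
    · exact (dualNorm_smul_le hnrm ha _).trans
        (mul_le_mul_of_nonneg_left (H.dual_norm_le i k) ha)
    · exact (dualNorm_smul_le hnrm hb _).trans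
        (mul_le_mul_of_nonneg_left (H'.dual_norm_le i k) hb)
  nonneg i k := add_nonneg (smul_nonneg ha (H.nonneg i k)) (smul_nonneg hb (H'.nonneg i k))

end Convexity

/-! ### Weak duality: feasible points certify the robust constraint -/

section WeakDuality

variable {d : ℕ}

/-- The signed loss `-(h · q + t)`. -/
def affineLoss (h : Fin d → ℝ) (t : ℝ) (q : Fin d → ℝ) : ℝ := -(h ⬝ᵥ q + t)

theorem continuous_affineLoss (h : Fin d → ℝ) (t : ℝ) : Continuous (affineLoss h t) :=
  ((continuous_dotProduct_left h).add continuous_const).neg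

/-- The integrand in the definition of the conditional value at risk. -/
noncomputable def cvarIntegrand (α τ : ℝ) (l : (Fin d → ℝ) → ℝ) (q : Fin d → ℝ) : ℝ :=
  τ + 1 / α * max (l q - τ) 0

theorem continuous_cvarIntegrand (α τ : ℝ) {l : (Fin d → ℝ) → ℝ} (hl : Continuous l) :
    Continuous (cvarIntegrand α τ l) := by
  unfold cvarIntegrand
  fun_prop

theorem integrable_dotProduct {Q : Measure (Fin d → ℝ)} (hQ : Integrable (fun q => q) Q)
    (h : Fin d → ℝ) : Integrable (fun q => h ⬝ᵥ q) Q := by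
  simp only [dotProduct]
  exact integrable_finsetSum _ fun i _ => (hQ.eval i).const_mul _

theorem integrable_cvarIntegrand {Q : Measure (Fin d → ℝ)} [IsFiniteMeasure Q]
    (hQ : Integrable (fun q => q) Q) (α τ : ℝ) (h : Fin d → ℝ) (t : ℝ) :
    Integrable (cvarIntegrand α τ (affineLoss h t)) Q := by
  have h1 : Integrable (affineLoss h t) Q :=
    ((integrable_dotProduct hQ h).add (integrable_const t)).neg
  exact (integrable_const τ).add
    (((h1.sub (integrable_const τ)).sup (integrable_const 0)).const_mul _)

theorem integrable_empirical {N : ℕ} (hN : 0 < N) (p : Fin N → Fin d → ℝ)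
    (f : (Fin d → ℝ) → ℝ) : Integrable f (empirical p) := by
  have : (N : ℝ≥0∞) ≠ 0 := by exact_mod_cast hN.ne'
  refine Integrable.smul_measure ?_ (ENNReal.inv_ne_top.2 this)
  rw [integrable_finsetSum_measure]
  exact fun i _ => integrable_dirac (by finiteness)

theorem integral_empirical {N : ℕ} (p : Fin N → Fin d → ℝ) (f : (Fin d → ℝ) → ℝ) :
    ∫ x, f x ∂(empirical p) = 1 / (N : ℝ) * ∑ i, f (p i) := by
  rw [empirical, integral_smul_measure, integral_finsetSum_measure
    (fun i _ => integrable_dirac (by finiteness))]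
  simp

/-- The easy half of Kantorovich duality: a function on `Ξ` that is majorized by
`η i + lam * nrm (· - p i)` for all `i` has expectation at most `lam * r + 1 / N * ∑ i, η i` under
any measure reached from the empirical measure by a coupling of cost at most `r`. -/
theorem integral_le_of_coupling {N : ℕ} (hN : 0 < N) {nrm : Seminorm ℝ (Fin d → ℝ)}
    {p : Fin N → Fin d → ℝ} {Ξ : Set (Fin d → ℝ)} {Q : Measure (Fin d → ℝ)}
    (hQΞ : Q Ξᶜ = 0) {F : (Fin d → ℝ) → ℝ} (hFc : Continuous F) (hF : Integrable F Q)
    {lam : ℝ} (hlam : 0 ≤ lam) {η : Fin N → ℝ}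
    (hFη : ∀ q ∈ Ξ, ∀ i, F q ≤ η i + lam * nrm (q - p i))
    {π : Measure ((Fin d → ℝ) × (Fin d → ℝ))} (h1 : π.map Prod.fst = empirical p)
    (h2 : π.map Prod.snd = Q) {r : ℝ} (hr : 0 ≤ r)
    (hcost : ∫⁻ ξ, ENNReal.ofReal (nrm (ξ.1 - ξ.2)) ∂π ≤ ENNReal.ofReal r) :
    ∫ q, F q ∂Q ≤ lam * r + 1 / (N : ℝ) * ∑ i, η i := by
  have : Nonempty (Fin N) := ⟨⟨0, hN⟩⟩
  have hnc := continuous_seminorm nrm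
  -- Samples may coincide, so `η` need not be a function of the sample point. This envelope is one,
  -- with `G (p i) ≤ η i`, and it avoids disintegrating the coupling over the samples.
  set G : (Fin d → ℝ) → ℝ :=
    fun x => Finset.univ.inf' Finset.univ_nonempty fun i => η i + lam * nrm (x - p i) with hG
  have hGc : Continuous G := by
    refine Continuous.finset_inf'_apply _ fun i _ => ?_
    fun_prop
  have hcc : Continuous fun ξ : (Fin d → ℝ) × (Fin d → ℝ) => nrm (ξ.1 - ξ.2) := by fun_prop
  have hci : Integrable (fun ξ : (Fin d → ℝ) × (Fin d → ℝ) => nrm (ξ.1 - ξ.2)) π :=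
    ⟨hcc.aestronglyMeasurable, by
      rw [hasFiniteIntegral_iff_ofReal (Filter.Eventually.of_forall fun ξ => apply_nonneg _ _)]
      exact hcost.trans_lt ENNReal.ofReal_lt_top⟩
  have hci' : ∫ ξ, nrm (ξ.1 - ξ.2) ∂π ≤ r := by
    rw [integral_eq_lintegral_of_nonneg_ae (Filter.Eventually.of_forall fun ξ => apply_nonneg _ _)
      hcc.aestronglyMeasurable]
    exact ENNReal.toReal_le_of_le_ofReal hr hcost
  have hGi : Integrable (fun ξ : (Fin d → ℝ) × (Fin d → ℝ) => G ξ.1) π := by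
    have := integrable_empirical hN p G
    rw [← h1] at this
    exact this.comp_measurable measurable_fst
  have hFi : Integrable (fun ξ : (Fin d → ℝ) × (Fin d → ℝ) => F ξ.2) π := by
    rw [← h2] at hF
    exact hF.comp_measurable measurable_snd
  have hae : ∀ᵐ ξ ∂π, ξ.2 ∈ Ξ := by
    rw [← h2] at hQΞ
    exact ae_of_ae_map (p := fun q => q ∈ Ξ) measurable_snd.aemeasurable hQΞ
  have hpt : ∀ᵐ ξ ∂π, F ξ.2 ≤ G ξ.1 + lam * nrm (ξ.1 - ξ.2) := by
    filter_upwards [hae] with ξ hξ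
    rw [← sub_le_iff_le_add, hG, Finset.le_inf'_iff]
    intro i _
    have htri : nrm (ξ.2 - p i) ≤ nrm (ξ.1 - p i) + nrm (ξ.1 - ξ.2) := by
      have := map_sub_le_add nrm (ξ.1 - p i) (ξ.1 - ξ.2)
      rwa [show ξ.1 - p i - (ξ.1 - ξ.2) = ξ.2 - p i by abel] at this
    nlinarith [hFη ξ.2 hξ i, mul_le_mul_of_nonneg_left htri hlam]
  calc ∫ q, F q ∂Q = ∫ ξ, F ξ.2 ∂π := by
        rw [← h2, integral_map measurable_snd.aemeasurable hFc.aestronglyMeasurable]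
    _ ≤ ∫ ξ, (G ξ.1 + lam * nrm (ξ.1 - ξ.2)) ∂π :=
        integral_mono_ae hFi (hGi.add (hci.const_mul _)) hpt
    _ = ∫ x, G x ∂(empirical p) + lam * ∫ ξ, nrm (ξ.1 - ξ.2) ∂π := by
        rw [integral_add hGi (hci.const_mul _), integral_const_mul, ← h1,
          integral_map measurable_fst.aemeasurable hGc.aestronglyMeasurable]
    _ ≤ 1 / (N : ℝ) * ∑ i, η i + lam * r := by
        refine add_le_add ?_ (mul_le_mul_of_nonneg_left hci' hlam)
        rw [integral_empirical]
        refine mul_le_mul_of_nonneg_left (Finset.sum_le_sum fun i _ => ?_) (by positivity)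
        refine (Finset.inf'_le _ (Finset.mem_univ i)).trans_eq ?_
        simp
    _ = lam * r + 1 / (N : ℝ) * ∑ i, η i := add_comm _ _

/-- Feasibility of the finite-dimensional program majorizes the integrand of the conditional value
at risk on the polyhedron. -/
theorem ReformFeasible.cvarIntegrand_le {m N : ℕ} {nrm : Seminorm ℝ (Fin d → ℝ)}
    (hnrm : ∀ x, nrm x = 0 → x = 0) {V : Matrix (Fin m) (Fin d) ℝ} {v : Fin m → ℝ}
    {p : Fin N → Fin d → ℝ} {h : Fin d → ℝ} {α ε δ gt τ lam : ℝ}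
    {η : Fin N → ℝ} {γ : Fin N → Fin 2 → Fin m → ℝ}
    (H : ReformFeasible nrm V v p h α ε δ gt τ lam η γ) {q : Fin d → ℝ}
    (hq : q ∈ polyhedron V v) (i : Fin N) :
    cvarIntegrand α τ (affineLoss h gt) q ≤ η i + lam * nrm (q - p i) := by
  -- The CVaR integrand is the maximum of two affine functions, indexed by `k`. Each is bounded by
  -- adding the nonnegative slack term `γ i k ⬝ᵥ (v - V *ᵥ q)` and paying for the move from `p i` to
  -- `q` with the dual norm.
  have key : ∀ k, coeffA α h k ⬝ᵥ q + coeffB α k * gt + coeffC α k * τ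
      ≤ η i + lam * nrm (q - p i) := by
    intro k
    have h1 := H.epigraph i k
    have h2 : -(Vᵀ *ᵥ γ i k - coeffA α h k) ⬝ᵥ (q - p i) ≤ lam * nrm (q - p i) := by
      have := dotProduct_le_dualNorm_mul hnrm (Vᵀ *ᵥ γ i k - coeffA α h k) (p i - q)
      rw [map_sub_rev] at this
      rw [neg_dotProduct, ← dotProduct_neg, neg_sub]
      exact this.trans (mul_le_mul_of_nonneg_right (H.dual_norm_le i k) (apply_nonneg _ _))
    have h3 : 0 ≤ γ i k ⬝ᵥ (v - V *ᵥ q) :=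
      dotProduct_nonneg_of_nonneg (H.nonneg i k) (sub_nonneg.2 hq)
    have h4 : ∀ x, (Vᵀ *ᵥ γ i k) ⬝ᵥ x = γ i k ⬝ᵥ (V *ᵥ x) := fun x => by
      rw [Matrix.mulVec_transpose, Matrix.dotProduct_mulVec]
    simp only [neg_dotProduct, sub_dotProduct, dotProduct_sub, h4] at h1 h2 h3
    linarith
  have h0 := key 0
  have h1 := key 1
  simp only [coeffA, coeffB, coeffC, Matrix.cons_val_zero, Matrix.cons_val_one, smul_dotProduct,
    zero_dotProduct, smul_eq_mul] at h0 h1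
  unfold cvarIntegrand affineLoss
  rcases le_total (-(h ⬝ᵥ q + gt) - τ) 0 with hle | hle
  · rw [max_eq_right hle]
    linarith
  · rw [max_eq_left hle]
    refine le_of_eq_of_le ?_ h0
    ring

/-- Weak duality: feasible points of the finite-dimensional program certify the distributionally
robust constraint. -/
theorem ReformFeasible.drcvar_le {m N : ℕ} (hN : 0 < N) {nrm : Seminorm ℝ (Fin d → ℝ)}
    (hnrm : ∀ x, nrm x = 0 → x = 0) {V : Matrix (Fin m) (Fin d) ℝ} {v : Fin m → ℝ}
    {p : Fin N → Fin d → ℝ} {h : Fin d → ℝ} {α ε δ gt τ lam : ℝ} (hε : 0 ≤ ε)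
    {η : Fin N → ℝ} {γ : Fin N → Fin 2 → Fin m → ℝ}
    (H : ReformFeasible nrm V v p h α ε δ gt τ lam η γ) :
    drcvar α (wassersteinBall nrm (polyhedron V v) (empirical p) ε) (affineLoss h gt)
      ≤ (δ : EReal) := by
  refine iSup₂_le fun Q hQ => ?_
  obtain ⟨⟨hQp, hQΞ, hQi⟩, hW⟩ := hQ
  refine (iInf_le _ τ).trans (EReal.coe_le_coe_iff.2 ?_)
  have hlam : 0 ≤ lam := (dualNorm_nonneg hnrm _).trans (H.dual_norm_le ⟨0, hN⟩ 0)
  refine le_trans ?_ H.budget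
  -- Attainment of the Wasserstein infimum is not needed: a coupling of cost below `r` exists for
  -- each `r > ε`, and then `r` tends to `ε`.
  have hbound : ∀ r, ε < r → ∫ q, cvarIntegrand α τ (affineLoss h gt) q ∂Q
      ≤ lam * r + 1 / (N : ℝ) * ∑ i, η i := by
    intro r hr
    have hlt : wasserstein nrm (empirical p) Q < ENNReal.ofReal r :=
      hW.trans_lt ((ENNReal.ofReal_lt_ofReal_iff (hε.trans_lt hr)).2 hr)
    simp only [wasserstein, iInf_lt_iff] at hlt
    obtain ⟨π, ⟨h1, h2⟩, hcost⟩ := hlt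
    exact integral_le_of_coupling hN hQΞ (continuous_cvarIntegrand α τ (continuous_affineLoss h gt))
      (integrable_cvarIntegrand hQi α τ h gt) hlam
      (fun q hq i => H.cvarIntegrand_le hnrm hq i) h1 h2 (hε.trans hr.le) hcost.le
  have hlim : Filter.Tendsto (fun r => lam * r + 1 / (N : ℝ) * ∑ i, η i) (nhdsWithin ε (Set.Ioi ε))
      (nhds (lam * ε + 1 / (N : ℝ) * ∑ i, η i)) :=
    ((by fun_prop : Continuous fun r => lam * r + 1 / (N : ℝ) * ∑ i, η i).tendsto ε).mono_left
      nhdsWithin_le_nhds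
  exact ge_of_tendsto hlim (by filter_upwards [self_mem_nhdsWithin] with r hr using hbound r hr)

end WeakDuality

/-! ### Two-point mixtures, used both as distributions and as couplings -/

section TwoPointMixture

variable {X Y : Type*} [MeasurableSpace X] [MeasurableSpace Y] {N : ℕ}

/-- The uniform mixture of the two-point distributions `w i • δ_{a i} + (1 - w i) • δ_{b i}`. -/
noncomputable def twoPointMixture (w : Fin N → ℝ) (a b : Fin N → X) : Measure X :=
  (N : ℝ≥0∞)⁻¹ • ∑ i, (ENNReal.ofReal (w i) • Measure.dirac (a i) +
    ENNReal.ofReal (1 - w i) • Measure.dirac (b i))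

theorem ofReal_add_ofReal_one_sub {t : ℝ} (h0 : 0 ≤ t) (h1 : t ≤ 1) :
    ENNReal.ofReal t + ENNReal.ofReal (1 - t) = 1 := by
  rw [← ENNReal.ofReal_add h0 (sub_nonneg.2 h1)]
  simp

theorem map_twoPointMixture (w : Fin N → ℝ) (a b : Fin N → X) {f : X → Y} (hf : Measurable f) :
    (twoPointMixture w a b).map f = twoPointMixture w (f ∘ a) (f ∘ b) := by
  simp only [twoPointMixture, Measure.map_smul]
  rw [← Measure.mapₗ_apply_of_measurable hf, map_sum]
  simp [Measure.mapₗ_apply_of_measurable hf, Measure.map_add _ _ hf, Measure.map_smul,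
    Measure.map_dirac' hf]

theorem twoPointMixture_self {d : ℕ} {w : Fin N → ℝ} (h0 : ∀ i, 0 ≤ w i) (h1 : ∀ i, w i ≤ 1)
    (p : Fin N → Fin d → ℝ) : twoPointMixture w p p = empirical p := by
  simp only [twoPointMixture, empirical]
  congr 1
  refine Finset.sum_congr rfl fun i _ => ?_
  rw [← add_smul, ofReal_add_ofReal_one_sub (h0 i) (h1 i), one_smul]

theorem isProbabilityMeasure_twoPointMixture (hN : 0 < N) {w : Fin N → ℝ} (h0 : ∀ i, 0 ≤ w i)
    (h1 : ∀ i, w i ≤ 1) (a b : Fin N → X) : IsProbabilityMeasure (twoPointMixture w a b) := by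
  constructor
  have : (N : ℝ≥0∞) ≠ 0 := by exact_mod_cast hN.ne'
  simp [twoPointMixture, ofReal_add_ofReal_one_sub (h0 _) (h1 _),
    ENNReal.inv_mul_cancel this (ENNReal.natCast_ne_top N)]

theorem twoPointMixture_eq_zero {w : Fin N → ℝ} {a b : Fin N → X} {S : Set X}
    (hS : MeasurableSet S) (ha : ∀ i, a i ∉ S) (hb : ∀ i, b i ∉ S) :
    twoPointMixture w a b S = 0 := by
  simp [twoPointMixture, Measure.dirac_apply' _ hS, ha, hb]

theorem integrable_twoPointMixture [MeasurableSingletonClass X] {F : Type*}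
    [NormedAddCommGroup F] (hN : 0 < N) (w : Fin N → ℝ) (a b : Fin N → X) (f : X → F) :
    Integrable f (twoPointMixture w a b) := by
  have : (N : ℝ≥0∞) ≠ 0 := by exact_mod_cast hN.ne'
  refine Integrable.smul_measure ?_ (ENNReal.inv_ne_top.2 this)
  rw [integrable_finsetSum_measure]
  exact fun i _ =>
    ((integrable_dirac (by finiteness)).smul_measure ENNReal.ofReal_ne_top).add_measure
    ((integrable_dirac (by finiteness)).smul_measure ENNReal.ofReal_ne_top)

theorem integral_twoPointMixture [MeasurableSingletonClass X] {w : Fin N → ℝ}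
    (h0 : ∀ i, 0 ≤ w i) (h1 : ∀ i, w i ≤ 1) (a b : Fin N → X) (f : X → ℝ) :
    ∫ x, f x ∂(twoPointMixture w a b)
      = 1 / (N : ℝ) * ∑ i, (w i * f (a i) + (1 - w i) * f (b i)) := by
  have hd : ∀ (c : ℝ) (x : X), Integrable f (ENNReal.ofReal c • Measure.dirac x) := fun c x =>
    (integrable_dirac (by finiteness)).smul_measure ENNReal.ofReal_ne_top
  rw [twoPointMixture, integral_smul_measure,
    integral_finsetSum_measure fun i _ => (hd _ _).add_measure (hd _ _)]
  simp only [ENNReal.toReal_inv, ENNReal.toReal_natCast, smul_eq_mul, one_div]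
  congr 1
  refine Finset.sum_congr rfl fun i _ => ?_
  rw [integral_add_measure (hd _ _) (hd _ _), integral_smul_measure, integral_smul_measure,
    integral_dirac, integral_dirac, ENNReal.toReal_ofReal (h0 i),
    ENNReal.toReal_ofReal (sub_nonneg.2 (h1 i)), smul_eq_mul, smul_eq_mul]

end TwoPointMixture

/-! ### Transport plans and the bound they inherit from the robust constraint -/

section Transport

variable {d m N : ℕ}

/-- The polytope of transport plans: the fraction `w i` of the mass of the `i`-th sample is moved by
the displacement `y i / w i` inside the polyhedron, and the moved mass is `α` in total. -/
def transportPolytope (V : Matrix (Fin m) (Fin d) ℝ) (v : Fin m → ℝ) (p : Fin N → Fin d → ℝ)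
    (α : ℝ) : Set ((Fin N → ℝ) × (Fin N → Fin d → ℝ)) :=
  {x | (∀ i, 0 ≤ x.1 i) ∧ (∀ i, x.1 i ≤ 1) ∧ ∑ i, x.1 i = N * α ∧
    ∀ i, V *ᵥ x.2 i ≤ x.1 i • (v - V *ᵥ p i)}

/-- The total transportation cost of a transport plan. -/
def transportCost (nrm : Seminorm ℝ (Fin d → ℝ)) :
    Seminorm ℝ ((Fin N → ℝ) × (Fin N → Fin d → ℝ)) :=
  Seminorm.of (fun x => ∑ i, nrm (x.2 i))
    (fun x y => by
      rw [← Finset.sum_add_distrib]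
      exact Finset.sum_le_sum fun i _ => map_add_le_add nrm _ _)
    (fun r x => by
      rw [Finset.mul_sum]
      exact Finset.sum_congr rfl fun i _ => map_smul_eq_mul nrm _ _)

theorem transportCost_apply (nrm : Seminorm ℝ (Fin d → ℝ))
    (x : (Fin N → ℝ) × (Fin N → Fin d → ℝ)) : transportCost nrm x = ∑ i, nrm (x.2 i) := rfl

theorem continuous_transportCost (nrm : Seminorm ℝ (Fin d → ℝ)) :
    Continuous (transportCost (N := N) nrm) := by
  have := continuous_seminorm nrm
  change Continuous fun x : (Fin N → ℝ) × (Fin N → Fin d → ℝ) => ∑ i, nrm (x.2 i)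
  fun_prop

/-- The expected tail loss of a transport plan, multiplied by `N`. -/
noncomputable def transportLoss (p : Fin N → Fin d → ℝ) (h : Fin d → ℝ) (α t : ℝ) :
    (Fin N → ℝ) × (Fin N → Fin d → ℝ) →ₗ[ℝ] ℝ where
  toFun x := 1 / α * ∑ i, (x.1 i * affineLoss h t (p i) - h ⬝ᵥ x.2 i)
  map_add' x y := by
    rw [← mul_add (1 / α), ← Finset.sum_add_distrib]
    congr 1
    refine Finset.sum_congr rfl fun i _ => ?_
    simp only [Prod.fst_add, Prod.snd_add, Pi.add_apply, dotProduct_add]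
    ring
  map_smul' r x := by
    rw [RingHom.id_apply, smul_eq_mul, mul_left_comm, Finset.mul_sum _ _ r]
    congr 1
    refine Finset.sum_congr rfl fun i _ => ?_
    simp only [Prod.smul_fst, Prod.smul_snd, Pi.smul_apply, dotProduct_smul, smul_eq_mul]
    ring

theorem transportLoss_apply (p : Fin N → Fin d → ℝ) (h : Fin d → ℝ) (α t : ℝ)
    (x : (Fin N → ℝ) × (Fin N → Fin d → ℝ)) : transportLoss p h α t x
      = 1 / α * ∑ i, (x.1 i * affineLoss h t (p i) - h ⬝ᵥ x.2 i) := rfl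

/-- No transport plan of average cost at most `ε` has an expected tail loss above `δ`. -/
def TransportBound (nrm : Seminorm ℝ (Fin d → ℝ)) (V : Matrix (Fin m) (Fin d) ℝ) (v : Fin m → ℝ)
    (p : Fin N → Fin d → ℝ) (h : Fin d → ℝ) (α ε δ t : ℝ) : Prop :=
  ∀ x ∈ transportPolytope V v p α, transportCost nrm x ≤ N * ε → transportLoss p h α t x ≤ N * δ

theorem convex_transportPolytope (V : Matrix (Fin m) (Fin d) ℝ) (v : Fin m → ℝ)
    (p : Fin N → Fin d → ℝ) (α : ℝ) : Convex ℝ (transportPolytope V v p α) := by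
  rintro x ⟨h1, h2, h3, h4⟩ y ⟨k1, k2, k3, k4⟩ a b ha hb hab
  refine ⟨fun i => ?_, fun i => ?_, ?_, fun i => ?_⟩
  · exact add_nonneg (mul_nonneg ha (h1 i)) (mul_nonneg hb (k1 i))
  · have := add_le_add (mul_le_mul_of_nonneg_left (h2 i) ha) (mul_le_mul_of_nonneg_left (k2 i) hb)
    rw [mul_one, mul_one, hab] at this
    exact this
  · simp only [Prod.fst_add, Prod.smul_fst, Pi.add_apply, Pi.smul_apply, smul_eq_mul,
      Finset.sum_add_distrib, ← Finset.mul_sum, h3, k3]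
    rw [← add_mul, hab, one_mul]
  · simp only [Prod.fst_add, Prod.snd_add, Prod.smul_fst, Prod.smul_snd, Pi.add_apply,
      Pi.smul_apply, Matrix.mulVec_add, Matrix.mulVec_smul, add_smul, smul_assoc]
    exact add_le_add (smul_le_smul_of_nonneg_left (h4 i) ha)
      (smul_le_smul_of_nonneg_left (k4 i) hb)

theorem const_mem_transportPolytope {V : Matrix (Fin m) (Fin d) ℝ} {v : Fin m → ℝ}
    {p : Fin N → Fin d → ℝ} (hp : ∀ i, p i ∈ polyhedron V v) {α : ℝ} (hα : 0 < α) (hα1 : α ≤ 1) :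
    ((fun _ => α, 0) : (Fin N → ℝ) × (Fin N → Fin d → ℝ)) ∈ transportPolytope V v p α := by
  refine ⟨fun _ => hα.le, fun _ => hα1, by simp, fun i => ?_⟩
  simp only [Pi.zero_apply, Matrix.mulVec_zero]
  exact smul_nonneg hα.le (sub_nonneg.2 (hp i))

/-- A transport plan that moves a positive fraction of each sample gives a distribution in the
Wasserstein ball, whose conditional value at risk is at least the expected tail loss. -/
theorem transportLoss_le_of_pos (hN : 0 < N) {nrm : Seminorm ℝ (Fin d → ℝ)}
    {V : Matrix (Fin m) (Fin d) ℝ} {v : Fin m → ℝ} {p : Fin N → Fin d → ℝ}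
    (hp : ∀ i, p i ∈ polyhedron V v) {h : Fin d → ℝ} {α ε δ t : ℝ} (hα : 0 < α)
    (H : drcvar α (wassersteinBall nrm (polyhedron V v) (empirical p) ε) (affineLoss h t)
      ≤ (δ : EReal)) {x : (Fin N → ℝ) × (Fin N → Fin d → ℝ)}
    (hx : x ∈ transportPolytope V v p α) (hpos : ∀ i, 0 < x.1 i)
    (hcost : transportCost nrm x ≤ N * ε) : transportLoss p h α t x ≤ N * δ := by
  obtain ⟨hw0, hw1, hsum, hy⟩ := hx
  have hN' : (0 : ℝ) < N := by exact_mod_cast hN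
  set q : Fin N → Fin d → ℝ := fun i => p i + (x.1 i)⁻¹ • x.2 i with hq
  have hqΞ : ∀ i, q i ∈ polyhedron V v := by
    intro i
    have h1 := smul_le_smul_of_nonneg_left (hy i) (inv_pos.2 (hpos i)).le
    rw [smul_smul, inv_mul_cancel₀ (hpos i).ne', one_smul, ← Matrix.mulVec_smul] at h1
    change V *ᵥ (p i + (x.1 i)⁻¹ • x.2 i) ≤ v
    rw [Matrix.mulVec_add]
    exact le_sub_iff_add_le'.1 h1
  have hΞ : MeasurableSet (polyhedron V v) :=
    (isClosed_le (f := fun q : Fin d → ℝ => V *ᵥ q) (g := fun _ => v)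
      (Continuous.matrix_mulVec continuous_const continuous_id) continuous_const).measurableSet
  have hball : twoPointMixture x.1 q p
      ∈ wassersteinBall nrm (polyhedron V v) (empirical p) ε := by
    refine ⟨⟨isProbabilityMeasure_twoPointMixture hN hw0 hw1 _ _,
      twoPointMixture_eq_zero hΞ.compl (fun i => not_not.2 (hqΞ i)) (fun i => not_not.2 (hp i)),
      integrable_twoPointMixture hN _ _ _ _⟩, ?_⟩
    -- The coupling sends the fraction `w i` of sample `i` to `q i` and leaves the rest in place.
    refine (iInf₂_le (twoPointMixture x.1 (fun i => (p i, q i)) (fun i => (p i, p i)))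
      ⟨?_, ?_⟩).trans ?_
    rotate_left
    · rw [map_twoPointMixture _ _ _ measurable_fst]
      exact twoPointMixture_self hw0 hw1 p
    · rw [map_twoPointMixture _ _ _ measurable_snd]
      rfl
    · rw [← ofReal_integral_eq_lintegral_ofReal (integrable_twoPointMixture hN _ _ _ _)
        (Filter.Eventually.of_forall fun ξ => apply_nonneg _ _),
        integral_twoPointMixture hw0 hw1]
      refine ENNReal.ofReal_le_ofReal ?_
      rw [one_div, inv_mul_le_iff₀ hN']
      refine le_of_eq_of_le (Finset.sum_congr rfl fun i _ => ?_) hcost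
      simp only [sub_self, map_zero, mul_zero, add_zero, hq, sub_add_cancel_left, map_neg_eq_map,
        map_smul_eq_mul, norm_inv, Real.norm_of_nonneg (hw0 i)]
      rw [mul_inv_cancel_left₀ (hpos i).ne']
  have hcvar : ((transportLoss p h α t x / N : ℝ) : EReal)
      ≤ cvar α (twoPointMixture x.1 q p) (affineLoss h t) := by
    refine le_iInf fun τ => EReal.coe_le_coe_iff.2 ?_
    rw [integral_twoPointMixture hw0 hw1, div_eq_inv_mul, one_div]
    refine mul_le_mul_of_nonneg_left ?_ (inv_pos.2 hN').le
    have hα' : 0 ≤ 1 / α := by positivity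
    -- The positive part is bounded below by its argument on the moved mass and by `0` on the rest.
    -- The leftover multiple of `τ` sums to zero since the moved mass is `α` on average, so the
    -- bound holds for every `τ`.
    have h1 : ∀ i, 1 / α * (x.1 i * affineLoss h t (p i) - h ⬝ᵥ x.2 i) + (1 - 1 / α * x.1 i) * τ
        ≤ x.1 i * (τ + 1 / α * max (affineLoss h t (q i) - τ) 0)
          + (1 - x.1 i) * (τ + 1 / α * max (affineLoss h t (p i) - τ) 0) := by
      intro i
      have e1 : x.1 i * affineLoss h t (q i) = x.1 i * affineLoss h t (p i) - h ⬝ᵥ x.2 i := by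
        simp only [affineLoss, hq, dotProduct_add, dotProduct_smul, smul_eq_mul]
        field_simp [(hpos i).ne']
        ring
      have e2 := mul_le_mul_of_nonneg_left (mul_le_mul_of_nonneg_left
        (le_max_left (affineLoss h t (q i) - τ) 0) hα') (hw0 i)
      have e3 := mul_nonneg (sub_nonneg.2 (hw1 i)) (mul_nonneg hα'
        (le_max_right (affineLoss h t (p i) - τ) 0))
      rw [← e1]
      linarith
    refine le_of_eq_of_le ?_ (Finset.sum_le_sum fun i _ => h1 i)
    have hs : ∑ i, (1 - 1 / α * x.1 i) = 0 := by
      rw [Finset.sum_sub_distrib, ← Finset.mul_sum, hsum]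
      simp only [Finset.sum_const, Finset.card_univ, Fintype.card_fin, nsmul_eq_mul, mul_one]
      field_simp
      ring
    rw [Finset.sum_add_distrib, ← Finset.mul_sum, ← Finset.sum_mul, hs, zero_mul, add_zero,
      transportLoss_apply]
  have hle := EReal.coe_le_coe_iff.1
    (hcvar.trans ((le_iSup₂ (f := fun Q _ => cvar α Q (affineLoss h t)) _ hball).trans H))
  rwa [div_le_iff₀ hN', mul_comm] at hle

/-- If `w i = 0`, then `y i` is a recession direction and `y i / w i` has no meaning. Mixing in a
little of the plan with constant weights `α` and no displacement makes all weights positive without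
raising the cost above the budget, and the loss is linear, so the bound survives the limit. -/
theorem transportBound_of_drcvar_le (hN : 0 < N) {nrm : Seminorm ℝ (Fin d → ℝ)}
    {V : Matrix (Fin m) (Fin d) ℝ} {v : Fin m → ℝ} {p : Fin N → Fin d → ℝ}
    (hp : ∀ i, p i ∈ polyhedron V v) {h : Fin d → ℝ} {α ε δ t : ℝ} (hα : 0 < α) (hα1 : α ≤ 1)
    (H : drcvar α (wassersteinBall nrm (polyhedron V v) (empirical p) ε) (affineLoss h t)
      ≤ (δ : EReal)) : TransportBound nrm V v p h α ε δ t := by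
  intro x hx hcost
  set x₀ : (Fin N → ℝ) × (Fin N → Fin d → ℝ) := (fun _ => α, 0) with hx₀
  have hmem := const_mem_transportPolytope hp hα hα1
  have key : ∀ θ : ℝ, 0 < θ → θ < 1 →
      (1 - θ) * transportLoss p h α t x + θ * transportLoss p h α t x₀ ≤ N * δ := by
    intro θ h0 h1
    have := transportLoss_le_of_pos hN hp hα H
      (convex_transportPolytope V v p α hx hmem (sub_pos.2 h1).le h0.le (sub_add_cancel 1 θ))
      (fun i => add_pos_of_nonneg_of_pos (mul_nonneg (sub_pos.2 h1).le (hx.1 i)) (mul_pos h0 hα))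
      (by
        have hz : transportCost nrm x₀ = 0 := by simp [transportCost_apply, hx₀]
        refine (map_add_le_add _ _ _).trans ?_
        rw [map_smul_eq_mul, map_smul_eq_mul, hz, mul_zero, add_zero,
          Real.norm_of_nonneg (sub_pos.2 h1).le]
        exact (mul_le_of_le_one_left (apply_nonneg _ _) (by linarith)).trans hcost)
    simpa only [map_add, map_smul, smul_eq_mul] using this
  have hlim : Filter.Tendsto
      (fun θ : ℝ => (1 - θ) * transportLoss p h α t x + θ * transportLoss p h α t x₀)
      (nhdsWithin 0 (Set.Ioo 0 1))
      (nhds ((1 - 0) * transportLoss p h α t x + 0 * transportLoss p h α t x₀)) :=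
    ((by fun_prop : Continuous fun θ : ℝ =>
      (1 - θ) * transportLoss p h α t x + θ * transportLoss p h α t x₀).tendsto 0).mono_left
      nhdsWithin_le_nhds
  have : (nhdsWithin (0 : ℝ) (Set.Ioo 0 1)).NeBot := left_nhdsWithin_Ioo_neBot one_pos
  have := le_of_tendsto hlim (by
    filter_upwards [self_mem_nhdsWithin] with θ hθ using key θ hθ.1 hθ.2)
  linarith

end Transport

/-! ### Strong duality: multipliers from the bound on transport plans -/

section StrongDuality

variable {d m N : ℕ}

/-- Linear programming duality on the polytope of transport plans. -/
theorem exists_multipliers_of_transportPolytope {V : Matrix (Fin m) (Fin d) ℝ} {v : Fin m → ℝ}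
    {p : Fin N → Fin d → ℝ} (hp : ∀ i, p i ∈ polyhedron V v) {α : ℝ} (hα : 0 < α) (hα1 : α ≤ 1)
    (g : (Fin N → ℝ) × (Fin N → Fin d → ℝ) →ₗ[ℝ] ℝ) (s : ℝ)
    (hg : ∀ x ∈ transportPolytope V v p α, g x ≤ s) :
    ∃ (γ : Fin N → Fin m → ℝ) (ν : Fin N → ℝ) (τ : ℝ), (∀ i, 0 ≤ γ i) ∧ (∀ i, 0 ≤ ν i) ∧
      (∀ i, g (Pi.single i 1, 0) + γ i ⬝ᵥ (v - V *ᵥ p i) ≤ ν i + τ) ∧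
      (∀ i y, g (0, Pi.single i y) = γ i ⬝ᵥ (V *ᵥ y)) ∧ ∑ i, ν i + τ * (N * α) ≤ s := by
  classical
  let W : Fin N → (Fin N → ℝ) × (Fin N → Fin d → ℝ) →ₗ[ℝ] ℝ := fun i =>
    LinearMap.proj i ∘ₗ LinearMap.fst ℝ _ _
  let R : Fin N × Fin m → (Fin N → ℝ) × (Fin N → Fin d → ℝ) →ₗ[ℝ] ℝ := fun k =>
    LinearMap.proj k.2 ∘ₗ V.mulVecLin ∘ₗ LinearMap.proj k.1 ∘ₗ LinearMap.snd ℝ _ _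
      - (v - V *ᵥ p k.1) k.2 • W k.1
  have hW : ∀ i x, W i x = x.1 i := fun _ _ => rfl
  have hR : ∀ i j x, R (i, j) x = (V *ᵥ x.2 i) j - (v - V *ᵥ p i) j * x.1 i := fun _ _ _ => rfl
  -- The blocks are the polyhedral rows, `0 ≤ w i`, `w i ≤ 1`, and the total mass equation split
  -- into two inequalities. The free multiplier `τ` is the difference of the last two multipliers;
  -- dropping that of `0 ≤ w i` leaves an inequality.
  let f : (Fin N × Fin m) ⊕ (Fin N ⊕ Fin N) ⊕ (Unit ⊕ Unit) →
      (Fin N → ℝ) × (Fin N → Fin d → ℝ) →ₗ[ℝ] ℝ :=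
    Sum.elim R (Sum.elim (Sum.elim (fun i => -W i) W)
      (Sum.elim (fun _ => ∑ i, W i) (fun _ => -∑ i, W i)))
  let b : (Fin N × Fin m) ⊕ (Fin N ⊕ Fin N) ⊕ (Unit ⊕ Unit) → ℝ :=
    Sum.elim 0 (Sum.elim (Sum.elim 0 1) (Sum.elim (fun _ => N * α) (fun _ => -(N * α))))
  have hmem : ∀ x, (∀ k, f k x ≤ b k) ↔ x ∈ transportPolytope V v p α := by
    intro x
    simp only [Sum.forall, f, b, Sum.elim_inl, Sum.elim_inr, Prod.forall, hR, hW,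
      LinearMap.neg_apply, LinearMap.sum_apply, Pi.zero_apply, Pi.one_apply, transportPolytope,
      Set.mem_ofPred_eq, Pi.le_def, Pi.smul_apply, smul_eq_mul, forall_const, sub_nonpos,
      Left.neg_nonpos_iff, neg_le_neg_iff]
    constructor
    · rintro ⟨h1, ⟨h2, h3⟩, h4, h5⟩
      exact ⟨h2, h3, le_antisymm h4 h5, fun i j => (h1 i j).trans_eq (mul_comm _ _)⟩
    · rintro ⟨h2, h3, h4, h1⟩
      exact ⟨fun i j => (h1 i j).trans_eq (mul_comm _ _), ⟨h2, h3⟩, h4.le, h4.ge⟩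
  obtain ⟨c, hc, hgc, hcs⟩ := affine_farkas f b g s
    ((hmem _).2 (const_mem_transportPolytope hp hα hα1)) fun x hx => hg x ((hmem x).1 hx)
  simp only [Fintype.sum_sum_type, Fintype.sum_prod_type, f, b, Sum.elim_inl, Sum.elim_inr, hR, hW,
    LinearMap.neg_apply, LinearMap.sum_apply, Pi.zero_apply, Pi.one_apply, Finset.univ_unique,
    Finset.sum_singleton, mul_zero, Finset.sum_const_zero, zero_add, mul_one] at hgc hcs
  refine ⟨fun i j => c (.inl (i, j)), fun i => c (.inr (.inl (.inr i))),
    c (.inr (.inr (.inl default))) - c (.inr (.inr (.inr default))), fun i j => hc _,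
    fun i => hc _, fun i => ?_, fun i y => ?_, ?_⟩
  · rw [hgc]
    have h1 : ∀ u : Fin N → ℝ, ∑ k, u k * (Pi.single i 1 : Fin N → ℝ) k = u i := fun u => by
      simp [Pi.single_apply]
    have h2 : ∑ k, (Pi.single i 1 : Fin N → ℝ) k = 1 := by simp
    have h3 : ∑ k, ∑ j, c (.inl (k, j)) * ((V *ᵥ (0 : Fin N → Fin d → ℝ) k) j
        - (v - V *ᵥ p k) j * (Pi.single i 1 : Fin N → ℝ) k)
        = -((fun j => c (.inl (i, j))) ⬝ᵥ (v - V *ᵥ p i)) := by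
      rw [← h1 fun k => -((fun j => c (.inl (k, j))) ⬝ᵥ (v - V *ᵥ p k))]
      refine Finset.sum_congr rfl fun k _ => ?_
      rw [dotProduct, ← Finset.sum_neg_distrib, Finset.sum_mul]
      refine Finset.sum_congr rfl fun j _ => ?_
      simp only [Pi.zero_apply, Matrix.mulVec_zero]
      ring
    have h4 := hc (.inr (.inl (.inl i)))
    simp only [h3, h2, h1, mul_neg, Finset.sum_neg_distrib]
    linarith
  · rw [hgc]
    simp only [Pi.zero_apply, mul_zero, neg_zero, Finset.sum_const_zero, add_zero, sub_zero]
    rw [Finset.sum_eq_single i]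
    · simp [dotProduct]
    · intro k _ hk
      simp [Pi.single_eq_of_ne hk]
    · simp
  · refine le_of_eq_of_le ?_ hcs
    ring

/-- The budget constraint on the transportation cost can be moved into the objective. -/
theorem TransportBound.exists_multiplier (hN : 0 < N) {nrm : Seminorm ℝ (Fin d → ℝ)}
    (hnrm : ∀ x, nrm x = 0 → x = 0) {V : Matrix (Fin m) (Fin d) ℝ} {v : Fin m → ℝ}
    {p : Fin N → Fin d → ℝ} (hp : ∀ i, p i ∈ polyhedron V v) {h : Fin d → ℝ} {α ε δ t : ℝ}
    (hα : 0 < α) (hα1 : α ≤ 1) (hε : 0 ≤ ε) (H : TransportBound nrm V v p h α ε δ t) :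
    ∃ lam : ℝ, 0 ≤ lam ∧ ∀ x ∈ transportPolytope V v p α,
      transportLoss p h α t x ≤ N * δ + lam * (transportCost nrm x - N * ε) := by
  have hN' : (0 : ℝ) < N := by exact_mod_cast hN
  rcases hε.eq_or_lt with rfl | hε
  -- Slater's condition fails at `ε = 0`. There the plan is compared with the one of equal weights
  -- and no displacement: the losses differ by at most this dual norm times the cost.
  · refine ⟨dualNorm nrm (-(1 / α) • h), dualNorm_nonneg hnrm _, fun x hx => ?_⟩
    obtain ⟨h1, h2, h3, h4⟩ := hx
    have hx' : ((x.1, 0) : (Fin N → ℝ) × (Fin N → Fin d → ℝ)) ∈ transportPolytope V v p α :=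
      ⟨h1, h2, h3, fun i => by
        simp only [Pi.zero_apply, Matrix.mulVec_zero]
        exact smul_nonneg (h1 i) (sub_nonneg.2 (hp i))⟩
    have hb := H _ hx' (by simp [transportCost_apply])
    rw [transportLoss_apply] at hb ⊢
    simp only [Pi.zero_apply, dotProduct_zero, sub_zero] at hb
    rw [Finset.sum_sub_distrib, mul_sub, mul_zero, sub_zero, transportCost_apply]
    have hc : -(1 / α * ∑ i, h ⬝ᵥ x.2 i) ≤ dualNorm nrm (-(1 / α) • h) * ∑ i, nrm (x.2 i) := by
      rw [← neg_mul, Finset.mul_sum, Finset.mul_sum]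
      refine Finset.sum_le_sum fun i _ => ?_
      have := dotProduct_le_dualNorm_mul hnrm (-(1 / α) • h) (x.2 i)
      rwa [smul_dotProduct, smul_eq_mul] at this
    linarith
  · refine exists_lagrange_multiplier
      ((transportCost nrm).convexOn.subset (Set.subset_univ _) (convex_transportPolytope V v p α))
      (transportLoss p h α t) (const_mem_transportPolytope hp hα hα1) ?_ H
    simpa [transportCost_apply] using mul_pos hN' hε

/-- Strong duality: a bound on the transport plans yields a feasible point of the
finite-dimensional program. -/
theorem TransportBound.exists_reformFeasible (hN : 0 < N) {nrm : Seminorm ℝ (Fin d → ℝ)}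
    (hnrm : ∀ x, nrm x = 0 → x = 0) {V : Matrix (Fin m) (Fin d) ℝ} {v : Fin m → ℝ}
    {p : Fin N → Fin d → ℝ} (hp : ∀ i, p i ∈ polyhedron V v) {h : Fin d → ℝ} {α ε δ t : ℝ}
    (hα : 0 < α) (hα1 : α ≤ 1) (hε : 0 ≤ ε) (H : TransportBound nrm V v p h α ε δ t) :
    ∃ (τ lam : ℝ) (η : Fin N → ℝ) (γ : Fin N → Fin 2 → Fin m → ℝ),
      ReformFeasible nrm V v p h α ε δ t τ lam η γ := by
  have hN' : (0 : ℝ) < N := by exact_mod_cast hN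
  obtain ⟨lam, hlam, hL⟩ := H.exists_multiplier hN hnrm hp hα hα1 hε
  let r : NNReal := ⟨lam, hlam⟩
  obtain ⟨z, hzρ, hzL⟩ := exists_linear_between (r • transportCost (N := N) nrm)
    (continuous_const.mul (continuous_transportCost nrm)) (convex_transportPolytope V v p α)
    ⟨_, const_mem_transportPolytope hp hα hα1⟩ (transportLoss p h α t) (N * δ - lam * (N * ε))
    (fun x hx => by
      change _ ≤ lam * transportCost nrm x
      linarith [hL x hx])
  replace hzρ : ∀ x, z x ≤ lam * ∑ i, nrm (x.2 i) := hzρ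
  obtain ⟨γ, ν, τ, hγ, hν, hw, hy, hb⟩ := exists_multipliers_of_transportPolytope hp hα hα1
    (transportLoss p h α t - z) (N * δ - lam * (N * ε)) (fun x hx => by
      rw [LinearMap.sub_apply]
      linarith [hzL x hx])
  have hinv : 1 / α * α = 1 := one_div_mul_cancel hα.ne'
  -- The mass constraint has right-hand side `N * α`, so its multiplier enters the budget as `α *
  -- τ`, which is the CVaR threshold. The second piece has `a₂ = 0` and needs no polyhedral
  -- multiplier.
  refine ⟨α * τ, lam, fun i => ν i + α * τ, fun i => ![γ i, 0], ?_, ?_, ?_, ?_⟩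
  · rw [Finset.sum_add_distrib, Finset.sum_const, Finset.card_univ, Fintype.card_fin, nsmul_eq_mul]
    have : N * (lam * ε + 1 / (N : ℝ) * (∑ i, ν i + N * (α * τ))) ≤ N * δ := by
      rw [mul_add, ← mul_assoc (N : ℝ) (1 / (N : ℝ)), mul_one_div_cancel hN'.ne', one_mul]
      linarith
    exact le_of_mul_le_mul_left this hN'
  · intro i k
    fin_cases k
    · have h1 := hw i
      -- The cost ignores the weights, so `z`, lying below a multiple of it in both directions,
      -- vanishes on them.
      have h2 : z (Pi.single i 1, 0) = 0 := by
        have e1 := hzρ (Pi.single i 1, 0)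
        have e2 := hzρ (-(Pi.single i 1, 0))
        rw [map_neg] at e2
        simp only [Prod.snd_neg, Pi.neg_apply, Pi.zero_apply, neg_zero, map_zero,
          Finset.sum_const_zero, mul_zero] at e1 e2
        linarith
      have h3 : transportLoss p h α t (Pi.single i 1, 0) = 1 / α * affineLoss h t (p i) := by
        rw [transportLoss_apply]
        simp [Pi.single_apply]
      rw [LinearMap.sub_apply, h2, h3] at h1
      simp only [coeffA, coeffB, coeffC, Fin.zero_eta, Matrix.cons_val_zero, smul_dotProduct,
        smul_eq_mul, affineLoss] at h1 ⊢
      linear_combination h1 - τ * hinv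
    · have := hν i
      simpa [coeffA, coeffB, coeffC] using this
  · intro i k
    fin_cases k
    · refine dualNorm_le_of_forall hlam fun x => ?_
      have h1 := hy i x
      have h2 := hzρ (-(0, Pi.single i x))
      have h3 : transportLoss p h α t (0, Pi.single i x) = -(1 / α * (h ⬝ᵥ x)) := by
        rw [transportLoss_apply, Finset.sum_eq_single i]
        · simp
        · intro k _ hk
          simp [Pi.single_eq_of_ne hk]
        · simp
      have h4 : ∑ k, nrm ((-(0, Pi.single i x) : (Fin N → ℝ) × (Fin N → Fin d → ℝ)).2 k)
          = nrm x := by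
        rw [Finset.sum_eq_single i]
        · simp
        · intro k _ hk
          simp [Pi.single_eq_of_ne hk]
        · simp
      rw [LinearMap.sub_apply, h3] at h1
      rw [map_neg, h4] at h2
      have h5 : (Vᵀ *ᵥ γ i) ⬝ᵥ x = γ i ⬝ᵥ (V *ᵥ x) := by
        rw [Matrix.mulVec_transpose, Matrix.dotProduct_mulVec]
      simp only [coeffA, Fin.zero_eta, Matrix.cons_val_zero, sub_dotProduct, smul_dotProduct,
        smul_eq_mul, h5]
      linear_combination h2 - h1
    · refine dualNorm_le_of_forall hlam fun x => ?_
      simpa [coeffA] using mul_nonneg hlam (apply_nonneg nrm x)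
  · intro i k
    fin_cases k
    · exact hγ i
    · exact le_rfl

end StrongDuality

/-! ### Existence of the least admissible offset -/

section OptimalValue

variable {d m N : ℕ}

theorem transportLoss_eq_sub (p : Fin N → Fin d → ℝ) (h : Fin d → ℝ) {α : ℝ} (hα : 0 < α) (t : ℝ)
    {V : Matrix (Fin m) (Fin d) ℝ} {v : Fin m → ℝ} {x : (Fin N → ℝ) × (Fin N → Fin d → ℝ)}
    (hx : x ∈ transportPolytope V v p α) :
    transportLoss p h α t x = transportLoss p h α 0 x - N * t := by
  have h1 : ∀ i, x.1 i * affineLoss h t (p i) - h ⬝ᵥ x.2 i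
      = (x.1 i * affineLoss h 0 (p i) - h ⬝ᵥ x.2 i) - x.1 i * t := fun i => by
    simp only [affineLoss]
    ring
  simp only [transportLoss_apply]
  rw [Finset.sum_congr rfl fun i _ => h1 i, Finset.sum_sub_distrib, ← Finset.sum_mul, hx.2.2.1,
    mul_sub]
  congr 1
  field_simp

/-- Weights lie in `[0, 1]` and displacements are controlled through the dual norm by the cost
budget, so the loss is bounded even though the polytope may be unbounded. -/
theorem exists_transportLoss_le {nrm : Seminorm ℝ (Fin d → ℝ)}
    (hnrm : ∀ x, nrm x = 0 → x = 0) (V : Matrix (Fin m) (Fin d) ℝ) (v : Fin m → ℝ)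
    (p : Fin N → Fin d → ℝ) (h : Fin d → ℝ) {α : ℝ} (hα : 0 < α) (ε t : ℝ) :
    ∃ C, ∀ x ∈ transportPolytope V v p α, transportCost nrm x ≤ N * ε →
      transportLoss p h α t x ≤ C := by
  refine ⟨1 / α * (∑ i, |affineLoss h t (p i)| + dualNorm nrm (-h) * (N * ε)), ?_⟩
  rintro x ⟨h1, h2, -, -⟩ hx
  rw [transportLoss_apply]
  refine mul_le_mul_of_nonneg_left ?_ (by positivity)
  calc ∑ i, (x.1 i * affineLoss h t (p i) - h ⬝ᵥ x.2 i)
      ≤ ∑ i, (|affineLoss h t (p i)| + dualNorm nrm (-h) * nrm (x.2 i)) := by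
        refine Finset.sum_le_sum fun i _ => ?_
        have e1 : x.1 i * affineLoss h t (p i) ≤ |affineLoss h t (p i)| :=
          (mul_le_mul_of_nonneg_left (le_abs_self _) (h1 i)).trans
            (mul_le_of_le_one_left (abs_nonneg _) (h2 i))
        have e2 := dotProduct_le_dualNorm_mul hnrm (-h) (x.2 i)
        rw [neg_dotProduct] at e2
        linarith
    _ = ∑ i, |affineLoss h t (p i)| + dualNorm nrm (-h) * transportCost nrm x := by
        rw [Finset.sum_add_distrib, ← Finset.mul_sum, transportCost_apply]
    _ ≤ _ := by
        gcongr
        exact dualNorm_nonneg hnrm _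

/-- The offsets that satisfy the bound on transport plans form a closed half-line. -/
theorem exists_isLeast_transportBound (hN : 0 < N) {nrm : Seminorm ℝ (Fin d → ℝ)}
    (hnrm : ∀ x, nrm x = 0 → x = 0) {V : Matrix (Fin m) (Fin d) ℝ} {v : Fin m → ℝ}
    {p : Fin N → Fin d → ℝ} (hp : ∀ i, p i ∈ polyhedron V v) (h : Fin d → ℝ) {α ε : ℝ} (δ : ℝ)
    (hα : 0 < α) (hα1 : α ≤ 1) (hε : 0 ≤ ε) :
    ∃ t, IsLeast {t | TransportBound nrm V v p h α ε δ t} t := by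
  have hN' : (0 : ℝ) < N := by exact_mod_cast hN
  set A : Set ℝ := (fun x => transportLoss p h α 0 x / N - δ) ''
    {x | x ∈ transportPolytope V v p α ∧ transportCost nrm x ≤ N * ε} with hA
  have hset : {t | TransportBound nrm V v p h α ε δ t} = upperBounds A := by
    ext t
    simp only [Set.mem_ofPred_eq, TransportBound, hA, mem_upperBounds, Set.forall_mem_image,
      and_imp]
    refine forall₃_congr fun x hx _ => ?_
    rw [transportLoss_eq_sub p h hα t hx, sub_le_iff_le_add, sub_le_iff_le_add, div_le_iff₀ hN']
    constructor <;> intro _ <;> linarith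
  have hne : A.Nonempty := ⟨_, _, ⟨const_mem_transportPolytope hp hα hα1, by
    simpa [transportCost_apply] using mul_nonneg hN'.le hε⟩, rfl⟩
  obtain ⟨C, hC⟩ := exists_transportLoss_le hnrm V v p h hα ε 0
  have hbdd : BddAbove A := ⟨C / N - δ, by
    rintro _ ⟨x, ⟨hx, hxc⟩, rfl⟩
    exact sub_le_sub_right (div_le_div_of_nonneg_right (hC x hx hxc) hN'.le) _⟩
  exact ⟨sSup A, hset ▸ isLUB_csSup hne hbdd⟩

end OptimalValue

end DRCVaR

/-! ### The equivalence and the common minimum -/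

theorem mainTheorem1 {d m N : ℕ} (hN : 0 < N)
    (nrm : Seminorm ℝ (Fin d → ℝ)) (hnrm : ∀ x, nrm x = 0 → x = 0)
    (V : Matrix (Fin m) (Fin d) ℝ) (v : Fin m → ℝ)
    (p : Fin N → Fin d → ℝ) (hp : ∀ i, p i ∈ DRCVaR.polyhedron V v)
    (𝒪 𝒜 : Set (Fin d → ℝ))
    (h𝒪 : 𝒪.Nonempty ∧ IsCompact 𝒪 ∧ Convex ℝ 𝒪) (h𝒜 : 𝒜.Nonempty ∧ IsCompact 𝒜 ∧ Convex ℝ 𝒜)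
    (h : Fin d → ℝ) (α ε δ : ℝ) (hα : 0 < α) (hα1 : α ≤ 1) (hε : 0 ≤ ε) :
    -- the reformulation is a convex program in the finitely many variables `g, τ, λ, η, γ`
    Convex ℝ {x : ℝ × ℝ × ℝ × (Fin N → ℝ) × (Fin N → Fin 2 → Fin m → ℝ) |
      DRCVaR.ReformFeasible nrm V v p h α ε δ (DRCVaR.gTilde 𝒪 𝒜 h x.1)
        x.2.1 x.2.2.1 x.2.2.2.1 x.2.2.2.2} ∧
    -- both problems have the same feasible offsets `g`
    (∀ g : ℝ,
      DRCVaR.drcvar α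
          (DRCVaR.wassersteinBall nrm (DRCVaR.polyhedron V v) (DRCVaR.empirical p) ε)
          (DRCVaR.loss 𝒪 𝒜 h g) ≤ (δ : EReal) ↔
        ∃ (τ lam : ℝ) (η : Fin N → ℝ) (γ : Fin N → Fin 2 → Fin m → ℝ),
          DRCVaR.ReformFeasible nrm V v p h α ε δ (DRCVaR.gTilde 𝒪 𝒜 h g) τ lam η γ) ∧
    -- both problems attain the same finite optimal value
    ∃ gstar : ℝ,
      IsLeast {g : ℝ | DRCVaR.drcvar α
          (DRCVaR.wassersteinBall nrm (DRCVaR.polyhedron V v) (DRCVaR.empirical p) ε)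
          (DRCVaR.loss 𝒪 𝒜 h g) ≤ (δ : EReal)} gstar ∧
      IsLeast {g : ℝ | ∃ (τ lam : ℝ) (η : Fin N → ℝ) (γ : Fin N → Fin 2 → Fin m → ℝ),
          DRCVaR.ReformFeasible nrm V v p h α ε δ (DRCVaR.gTilde 𝒪 𝒜 h g) τ lam η γ} gstar := by
  have hdr : ∀ g : ℝ, DRCVaR.drcvar α
      (DRCVaR.wassersteinBall nrm (DRCVaR.polyhedron V v) (DRCVaR.empirical p) ε)
      (DRCVaR.loss 𝒪 𝒜 h g) ≤ (δ : EReal) ↔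
      DRCVaR.TransportBound nrm V v p h α ε δ (DRCVaR.gTilde 𝒪 𝒜 h g) := fun g =>
    ⟨DRCVaR.transportBound_of_drcvar_le hN hp hα hα1, fun H => by
      obtain ⟨τ, lam, η, γ, hf⟩ := H.exists_reformFeasible hN hnrm hp hα hα1 hε
      exact hf.drcvar_le hN hnrm hε⟩
  have hiff : ∀ g : ℝ, DRCVaR.drcvar α
      (DRCVaR.wassersteinBall nrm (DRCVaR.polyhedron V v) (DRCVaR.empirical p) ε)
      (DRCVaR.loss 𝒪 𝒜 h g) ≤ (δ : EReal) ↔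
      ∃ (τ lam : ℝ) (η : Fin N → ℝ) (γ : Fin N → Fin 2 → Fin m → ℝ),
        DRCVaR.ReformFeasible nrm V v p h α ε δ (DRCVaR.gTilde 𝒪 𝒜 h g) τ lam η γ := fun g =>
    ⟨fun H => ((hdr g).1 H).exists_reformFeasible hN hnrm hp hα hα1 hε, by
      rintro ⟨τ, lam, η, γ, hf⟩
      exact hf.drcvar_le hN hnrm hε⟩
  refine ⟨?_, hiff, ?_⟩
  · intro x hx y hy a b ha hb hab
    have := DRCVaR.ReformFeasible.combo hnrm hx hy ha hb hab
    rw [← DRCVaR.gTilde_combo 𝒪 𝒜 h hab] at this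
    exact this
  · obtain ⟨t, ht, hmin⟩ := DRCVaR.exists_isLeast_transportBound hN hnrm hp h δ hα hα1 hε
    have hleast : IsLeast {g : ℝ | DRCVaR.drcvar α
        (DRCVaR.wassersteinBall nrm (DRCVaR.polyhedron V v) (DRCVaR.empirical p) ε)
        (DRCVaR.loss 𝒪 𝒜 h g) ≤ (δ : EReal)}
        (t + (DRCVaR.supportFn 𝒪 h + DRCVaR.supportFn (-𝒜) h)) := by
      constructor
      · refine (hdr _).2 ?_
        rw [DRCVaR.gTilde, add_sub_cancel_right]
        exact ht
      · intro g hg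
        exact le_sub_iff_add_le.1 (hmin ((hdr g).1 hg))
    refine ⟨_, hleast, ?_⟩
    simpa only [hiff] using hleast
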